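/- Let $\langle z,w\rangle=w^*Jz$ be the Hermitian form of signature $(2,1)$ on $\mathbb C^3$ given by $J=\begin{pmatrix}0&0&1\\0&1&0\\1&0&0\end{pmatrix}$, and call a vector $v$ positive (negative) if $\langle v,v\rangle>0$ ($<0$). Let $\mathbf H^2_{\mathbb C}\subset\mathbb{CP}^2$ be the set of complex lines spanned by negative vectors, with the Bergman distance $\rho$ determined by $$\cosh^2\frac{\rho(z,w)}2=\frac{\langle z,w\rangle\langle w,z\rangle}{\langle z,z\rangle\langle w,w\rangle}.$$ Let $\mathrm{PU}(2,1)$ be the group $U(2,1)$ of linear automorphisms of the form modulo its scalar matrices, acting on $\mathbf H^2_{\mathbb C}$; an element is elliptic if it fixes a point of $\mathbf H^2_{\mathbb C}$. An element of $\mathrm{PU}(2,1)$ is a complex reflection in a complex line if it is represented by a matrix with a two-dimensional eigenspace that contains both positive and negative vectors; its fixed set in $\mathbf H^2_{\mathbb C}$ is then a complex line. It is a complex reflection in a point if it is represented by a matrix with an eigenspace spanned by a negative vector and a two-dimensional positive definite eigenspace; its fixed set in $\mathbf H^2_{\mathbb C}$ is then a point. Let $f,g\in \mathrm{PU}(2,1)$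 be elliptic elements of finite orders $m$ and $n$ such that one of the following holds: (1) $f$ and $g$ are complex reflections in complex lines; (2) $f$ is a complex reflection in a complex line and $g$ is a complex reflection in a point; (3) $f$ and $g$ are complex reflections in points. (Then $m,n\ge 2$.) Let $\delta(f,g)$ be the Bergman distance between the complex lines or points fixed by $f$ and $g$, that is, the infimum of $\rho(z,w)$ over the points $z,w\in\mathbf H^2_{\mathbb C}$ fixed by $f$ and $g$ respectively. If $$\cosh\delta(f,g)>\frac{\cos\frac{\pi}{m}\cos\frac{\pi}{n}+1}{\sin\frac{\pi}{m}\sin\frac{\pi}{n}},$$ then the subgroup $\langle f,g\rangle$ of $\mathrm{PU}(2,1)$ is discrete, and it is the free product of its subgroups $\langle f\rangle$ and $\langle g\rangle$: there is an isomorphism $\langle f\rangle*\langle g\rangle\to\langle f,g\rangle$ that restricts to the inclusions of $\langle f\rangle$ and $\langle g\rangle$. In particular $\langle f,g\rangle\cong\mathbf Z_m*\mathbf Z_n$. -/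

import Mathlib

open scoped Matrix LinearAlgebra.Projectivization

noncomputable section

namespace ComplexHyperbolic

/-- The space `ℂ³`, which carries the Hermitian form `herm` of signature `(2,1)`. -/
abbrev V : Type := Fin 3 → ℂ

/-- The matrix of the second Hermitian form. -/
def J : Matrix (Fin 3) (Fin 3) ℂ := !![0, 0, 1; 0, 1, 0; 1, 0, 0]

/-- The Hermitian form `⟨z, w⟩ = w* J z`. -/
def herm (z w : V) : ℂ := star w ⬝ᵥ (J *ᵥ z)

/-- The value `⟨v, v⟩`, which is a real number. -/
def q (v : V) : ℝ := (herm v v).re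

/-- The unitary group `U(2,1)` of the Hermitian form. -/
def U21 : Subgroup (GL (Fin 3) ℂ) where
  carrier := {B | ∀ z w : V, herm (B.val *ᵥ z) (B.val *ᵥ w) = herm z w}
  one_mem' := by intro z w; simp
  mul_mem' := by
    intro A B hA hB z w
    have h := hA (B.val *ᵥ z) (B.val *ᵥ w)
    simp only [Matrix.mulVec_mulVec] at h
    simpa using h.trans (hB z w)
  inv_mem' := by
    intro B hB z w
    have h := hB ((B⁻¹).val *ᵥ z) ((B⁻¹).val *ᵥ w)
    simpa only [Matrix.mulVec_mulVec, Units.mul_inv, Matrix.one_mulVec] using h.symm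

/-- The scalar matrices in `U(2,1)`. -/
def scalars : Subgroup U21 where
  carrier := {B | ∃ c : ℂ, B.val.val = c • (1 : Matrix (Fin 3) (Fin 3) ℂ)}
  one_mem' := ⟨1, by simp⟩
  mul_mem' := by
    rintro A B ⟨a, ha⟩ ⟨b, hb⟩
    exact ⟨a * b, by simp [ha, hb, smul_smul, mul_comm]⟩
  inv_mem' := by
    rintro B ⟨b, hb⟩
    have h : B.val.val * (B⁻¹).val.val = 1 := by
      rw [← Units.val_mul, ← Subgroup.coe_mul]; simp
    have hb0 : b ≠ 0 := by
      rintro rfl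
      rw [hb] at h
      simp at h
    refine ⟨b⁻¹, ?_⟩
    rw [hb, smul_mul_assoc, one_mul] at h
    rw [← h, smul_smul, inv_mul_cancel₀ hb0, one_smul]

instance : scalars.Normal where
  conj_mem := by
    rintro B ⟨b, hb⟩ A
    refine ⟨b, ?_⟩
    have h : A.val.val * (A⁻¹).val.val = 1 := by
      rw [← Units.val_mul, ← Subgroup.coe_mul]; simp
    simp only [Subgroup.coe_mul, Units.val_mul, hb]
    rw [mul_smul_comm, mul_one, smul_mul_assoc, h]

/-- The group `PU(2,1)`, with the quotient of the usual topology of `U(2,1)`. -/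
abbrev PU21 : Type := U21 ⧸ scalars

/-- The complex projective plane. -/
abbrev P2 : Type := ℙ ℂ V

/-- The action of `PU(2,1)` on the complex projective plane, induced by the action of `U(2,1)`
by projective transformations, `B • [v] = [B v]`. -/
def act : PU21 →* Equiv.Perm P2 :=
  QuotientGroup.lift scalars (MulAction.toPermHom U21 P2) (by
    rintro B ⟨b, hb⟩
    ext p
    induction p using Projectivization.ind with
    | h v hv =>
      refine (Projectivization.mk_eq_mk_iff' ℂ (B.val.val *ᵥ v) v _ hv).2 ⟨b, ?_⟩
      rw [hb, Matrix.smul_mulVec, Matrix.one_mulVec])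

/-- The complex hyperbolic plane: the set of negative points of the projective plane. -/
def CH2 : Set P2 := {p | q p.rep < 0}

/-- The Bergman distance `ρ` on the complex hyperbolic plane, given by
`cosh² (ρ(z,w)/2) = ⟨z,w⟩⟨w,z⟩ / (⟨z,z⟩⟨w,w⟩)`. -/
def bergmanDist (z w : P2) : ℝ :=
  2 * Real.arcosh (Real.sqrt
    ((herm z.rep w.rep * herm w.rep z.rep).re / (q z.rep * q w.rep)))

/-- The set of points of the complex hyperbolic plane that are fixed by `f`. -/
def fixedSet (f : PU21) : Set P2 := {p | p ∈ CH2 ∧ act f p = p}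

/-- An element of `PU(2,1)` is elliptic if it fixes a point of the complex hyperbolic plane. -/
def IsElliptic (f : PU21) : Prop := (fixedSet f).Nonempty

/-- The eigenspace of the matrix `B` for the eigenvalue `μ`. -/
def eigen (B : U21) (μ : ℂ) : Submodule ℂ V :=
  Module.End.eigenspace (Matrix.toLin' B.val.val) μ

/-- `f` is a complex reflection in a complex line: it has a repeated eigenvalue with a
two-dimensional eigenspace that contains both positive and negative vectors.
The fixed set of `f` in the complex hyperbolic plane is then the complex line formed by the
negative points of this eigenspace. -/
def IsLineReflection (f : PU21) : Prop :=
  ∃ (B : U21) (μ : ℂ), (B : PU21) = f ∧ Module.finrank ℂ (eigen B μ) = 2 ∧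
    (∃ v ∈ eigen B μ, 0 < q v) ∧ (∃ v ∈ eigen B μ, q v < 0)

/-- `f` is a complex reflection in a point: it has an eigenspace spanned by a negative vector `w`
and a repeated eigenvalue with a positive definite two-dimensional eigenspace.
The fixed set of `f` in the complex hyperbolic plane is then the point given by `w`. -/
def IsPointReflection (f : PU21) : Prop :=
  ∃ (B : U21) (μ ν : ℂ) (w : V), (B : PU21) = f ∧ q w < 0 ∧ eigen B ν = Submodule.span ℂ {w} ∧
    Module.finrank ℂ (eigen B μ) = 2 ∧ ∀ v ∈ eigen B μ, v ≠ 0 → 0 < q v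

/-- The Bergman distance between the fixed sets of `f` and `g`, that is, for complex reflections,
between the complex lines or points that they fix. -/
def fixedDist (f g : PU21) : ℝ :=
  sInf (Set.image2 bergmanDist (fixedSet f) (fixedSet g))

end ComplexHyperbolic

end

open ComplexHyperbolic

/-! Choose negative vectors `p` and `r`, fixed projectively by `f` and `g`, such that both elements
preserve the complex line spanned by `p` and `r` and act on it as rotations about these points. For
a point reflection the vector is the centre; for a line reflection it is the projection of the other
fixed point or polar vector to the fixed line. Two line reflections need ultraparallel lines, which
follows from `1 < cosh δ` (`cosh_fixedDist_le_one`, `exists_isRotation`).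

Project negative vectors to this line. The open sector at `p` of half-angle `π / m` around the ray
to `r` is moved off itself by every nontrivial power of `f`
(`IsRotation.exists_mulVec_notMem_sectorSet`), and likewise for `g` at `r`. A hyperbolic triangle
with angles `π / m`, `π / n`, `0` has its finite side of length `δ` with `cosh δ` equal to the bound
of the theorem. Beyond that length the sides of the two sectors do not meet, so the complements of
the sectors are disjoint (`mem_sectorSet_or_mem_sectorSet`).

The complements are thus ping-pong sets, and a point `v` in both sectors is a base point outside
them. Every nontrivial word moves `v` out of one of the sectors, which gives freeness. The elements
that keep `v` in both sectors form an open neighbourhood of `1` containing no other element of the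
group, which gives discreteness (`discrete_and_free_product_of_isRotation`). -/

namespace ComplexHyperbolic

/-! ### The Hermitian form: orthogonal projection and reverse Cauchy–Schwarz -/

theorem herm_apply (z w : V) :
    herm z w = star (w 0) * z 2 + star (w 1) * z 1 + star (w 2) * z 0 := by
  simp [herm, J, Matrix.mulVec, dotProduct, Fin.sum_univ_three]

theorem herm_add_left (x y w : V) : herm (x + y) w = herm x w + herm y w := by
  simp only [herm_apply, Pi.add_apply]; ring

theorem herm_sub_left (x y w : V) : herm (x - y) w = herm x w - herm y w := by
  simp only [herm_apply, Pi.sub_apply]; ring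

theorem herm_smul_left (c : ℂ) (x w : V) : herm (c • x) w = c * herm x w := by
  simp only [herm_apply, Pi.smul_apply, smul_eq_mul]; ring

theorem star_herm (x y : V) : star (herm x y) = herm y x := by
  simp only [herm_apply, star_add, star_mul', star_star]; ring

theorem herm_add_right (x y w : V) : herm w (x + y) = herm w x + herm w y := by
  rw [← star_herm, herm_add_left, star_add, star_herm, star_herm]

theorem herm_sub_right (x y w : V) : herm w (x - y) = herm w x - herm w y := by
  rw [← star_herm, herm_sub_left, star_sub, star_herm, star_herm]

theorem herm_smul_right (c : ℂ) (x w : V) : herm w (c • x) = star c * herm w x := by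
  rw [← star_herm, herm_smul_left, star_mul', star_herm]

theorem herm_self (v : V) : herm v v = (q v : ℂ) := by
  have h := star_herm v v
  exact (Complex.conj_eq_iff_re.1 h).symm

theorem herm_mul_herm (x y : V) : herm x y * herm y x = ((‖herm x y‖ ^ 2 : ℝ) : ℂ) := by
  rw [← star_herm x y]
  simpa using Complex.mul_conj' (herm x y)

theorem norm_herm_comm (x y : V) : ‖herm x y‖ = ‖herm y x‖ := by
  rw [← star_herm, norm_star]

theorem q_smul (c : ℂ) (v : V) : q (c • v) = ‖c‖ ^ 2 * q v := by
  have h : herm (c • v) (c • v) = ((‖c‖ ^ 2 * q v : ℝ) : ℂ) := by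
    rw [herm_smul_left, herm_smul_right, herm_self, ← mul_assoc]
    have := Complex.mul_conj' c
    simp only [Complex.star_def, this]
    push_cast; ring
  rw [herm_self] at h
  exact_mod_cast h

theorem q_zero : q 0 = 0 := by simp [q, herm]

theorem ne_zero_of_q_neg {v : V} (h : q v < 0) : v ≠ 0 := by
  rintro rfl
  rw [q_zero] at h
  exact lt_irrefl _ h

/-- The component of `x` orthogonal to `w`. -/
noncomputable def perp (x w : V) : V := x - (herm x w / (q w : ℂ)) • w

theorem herm_perp {x w : V} (hw : q w ≠ 0) : herm (perp x w) w = 0 := by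
  have : (q w : ℂ) ≠ 0 := by exact_mod_cast hw
  rw [perp, herm_sub_left, herm_smul_left, herm_self]
  field_simp
  ring

theorem q_perp {x w : V} (hw : q w ≠ 0) : q (perp x w) = q x - ‖herm x w‖ ^ 2 / q w := by
  have hc : (q w : ℂ) ≠ 0 := by exact_mod_cast hw
  have h : herm (perp x w) (perp x w) = ((q x - ‖herm x w‖ ^ 2 / q w : ℝ) : ℂ) := by
    conv_lhs => enter [2]; rw [perp]
    rw [herm_sub_right, herm_smul_right, herm_perp hw, mul_zero, sub_zero, perp, herm_sub_left,
      herm_smul_left, herm_self, div_mul_eq_mul_div, herm_mul_herm]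
    push_cast; ring
  rw [herm_self] at h
  exact_mod_cast h

/-- The form has only one negative direction. In diagonal coordinates, orthogonality and
Cauchy–Schwarz for the positive part bound the negative coordinate. -/
theorem q_pos_of_herm_eq_zero {a w : V} (hw : q w < 0) (h : herm a w = 0) (ha : a ≠ 0) :
    0 < q a := by
  -- The coordinates `v 1`, `v 0 + v 2`, `v 0 - v 2` diagonalise `J`, with signs `+`, `+`, `-`.
  have hq : ∀ v : V, 2 * q v =
      2 * ‖v 1‖ ^ 2 + ‖v 0 + v 2‖ ^ 2 - ‖v 0 - v 2‖ ^ 2 := by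
    intro v
    simp only [q, herm_apply, ← Complex.normSq_eq_norm_sq, Complex.normSq_apply]
    simp
    ring
  have h2 : (a 0 - a 2) * star (w 0 - w 2) =
      2 * (a 1 * star (w 1)) + (a 0 + a 2) * star (w 0 + w 2) := by
    rw [herm_apply] at h
    simp only [star_sub, star_add]
    linear_combination (-2) * h
  have h3 : ‖a 0 - a 2‖ * ‖w 0 - w 2‖ ≤
      2 * (‖a 1‖ * ‖w 1‖) + ‖a 0 + a 2‖ * ‖w 0 + w 2‖ := by
    have := norm_add_le (2 * (a 1 * star (w 1))) ((a 0 + a 2) * star (w 0 + w 2))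
    rw [← h2] at this
    simpa only [norm_mul, norm_star, Complex.norm_ofNat] using this
  have hqa := hq a
  have hqw := hq w
  have hn := fun i j => norm_nonneg (a i + a j)
  by_contra hcon
  rw [not_lt] at hcon
  have key : ∀ {α β γ α' β' γ' : ℝ}, 0 ≤ α → 0 ≤ β → 0 ≤ γ → 0 ≤ α' → 0 ≤ β' → 0 ≤ γ' →
      γ * γ' ≤ 2 * (α * α') + β * β' → 2 * α ^ 2 + β ^ 2 ≤ γ ^ 2 →
      2 * α' ^ 2 + β' ^ 2 < γ' ^ 2 → γ = 0 := by
    intro α β γ α' β' γ' _ _ h0 _ _ _ h1 h2 h3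
    by_contra hγ
    have hγ : 0 < γ := lt_of_le_of_ne h0 (Ne.symm hγ)
    have h4 : (γ * γ') ^ 2 ≤ (2 * (α * α') + β * β') ^ 2 := by gcongr
    have h5 : (2 * (α * α') + β * β') ^ 2 ≤ (2 * α ^ 2 + β ^ 2) * (2 * α' ^ 2 + β' ^ 2) := by
      nlinarith [sq_nonneg (α * β' - α' * β)]
    have h6 : (2 * α ^ 2 + β ^ 2) * (2 * α' ^ 2 + β' ^ 2) ≤ γ ^ 2 * (2 * α' ^ 2 + β' ^ 2) := by
      gcongr
    have h7 : γ ^ 2 * (2 * α' ^ 2 + β' ^ 2) < γ ^ 2 * γ' ^ 2 := by gcongr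
    nlinarith
  have hz := key (norm_nonneg (a 1)) (norm_nonneg (a 0 + a 2)) (norm_nonneg (a 0 - a 2))
    (norm_nonneg (w 1)) (norm_nonneg (w 0 + w 2)) (norm_nonneg (w 0 - w 2)) h3
    (by linarith) (by linarith)
  rw [hz] at hqa
  have e1 : ‖a 1‖ = 0 := by
    have : ‖a 1‖ ^ 2 = 0 := by nlinarith [sq_nonneg ‖a 1‖, sq_nonneg ‖a 0 + a 2‖]
    exact pow_eq_zero_iff (two_ne_zero) |>.1 this
  have e2 : ‖a 0 + a 2‖ = 0 := by
    have : ‖a 0 + a 2‖ ^ 2 = 0 := by nlinarith [sq_nonneg ‖a 1‖, sq_nonneg ‖a 0 + a 2‖]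
    exact pow_eq_zero_iff (two_ne_zero) |>.1 this
  rw [norm_eq_zero] at e1 e2 hz
  apply ha
  have e0 : a 0 = 0 := by linear_combination (e2 + hz) / 2
  have e3 : a 2 = 0 := by linear_combination (e2 - hz) / 2
  ext i
  fin_cases i <;> simp [e0, e1, e3]

theorem herm_ne_zero {z w : V} (hz : q z ≤ 0) (hz0 : z ≠ 0) (hw : q w < 0) : herm z w ≠ 0 :=
  fun h => (q_pos_of_herm_eq_zero hw h hz0).not_ge hz

/-- The reverse Cauchy–Schwarz inequality for negative vectors. -/
theorem mul_q_le_norm_herm_sq {z w : V} (hw : q w < 0) :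
    q z * q w ≤ ‖herm z w‖ ^ 2 := by
  have h0 : 0 ≤ q (perp z w) := by
    by_cases h : perp z w = 0
    · rw [h, q_zero]
    · exact (q_pos_of_herm_eq_zero hw (herm_perp hw.ne) h).le
  rw [q_perp hw.ne, sub_nonneg, div_le_iff_of_neg hw] at h0
  exact h0

theorem herm_nondegenerate {y : V} (h : ∀ v, herm y v = 0) : y = 0 := by
  have h0 := h ![1, 0, 0]
  have h1 := h ![0, 1, 0]
  have h2 := h ![0, 0, 1]
  simp [herm_apply] at h0 h1 h2
  ext i
  fin_cases i <;> simp [h0, h1, h2]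

theorem U21.herm_mulVec (B : U21) (z w : V) :
    herm (B.val.val *ᵥ z) (B.val.val *ᵥ w) = herm z w := B.2 z w

theorem U21.q_mulVec (B : U21) (z : V) : q (B.val.val *ᵥ z) = q z := by
  simp only [q, U21.herm_mulVec]

theorem U21.herm_mulVec_of_eigen {B : U21} {p : V} {α : ℂ} (hα : ‖α‖ = 1)
    (h : B.val.val *ᵥ p = α • p) (v : V) : herm (B.val.val *ᵥ v) p = α * herm v p := by
  have h1 := U21.herm_mulVec B v p
  rw [h, herm_smul_right] at h1
  have h2 := Complex.mul_conj' α
  rw [hα] at h2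
  simp only [Complex.star_def] at h1
  rw [← h1, ← mul_assoc, h2]
  simp

theorem U21.pow_mulVec_of_eigen {B : U21} {p : V} {α : ℂ}
    (h : B.val.val *ᵥ p = α • p) (k : ℕ) : (B ^ k).val.val *ᵥ p = α ^ k • p := by
  induction k with
  | zero => simp
  | succ k ih =>
    rw [pow_succ, Subgroup.coe_mul, Units.val_mul, ← Matrix.mulVec_mulVec, h, Matrix.mulVec_smul,
      ih, smul_smul, pow_succ, mul_comm]

theorem U21.norm_eq_one_of_eigen {B : U21} {p : V} {α : ℂ} (hp : q p ≠ 0)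
    (h : B.val.val *ᵥ p = α • p) : ‖α‖ = 1 := by
  have h1 := U21.q_mulVec B p
  rw [h, q_smul] at h1
  have h2 : ‖α‖ ^ 2 = 1 := mul_right_cancel₀ hp (by rw [h1, one_mul])
  exact (pow_eq_one_iff_of_nonneg (norm_nonneg _) two_ne_zero).1 h2

end ComplexHyperbolic

/-! ### Ping-pong with a base point -/

namespace Monoid.CoprodI

open scoped Pointwise in
/-- A version of the ping-pong lemma with a base point outside of the ping-pong sets. -/
theorem lift_smul_mem_of_ping_pong {ι G α : Type*} [Group G] [MulAction G α] {H : ι → Type*}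
    [∀ i, Group (H i)] (φ : ∀ i, H i →* G) (X : ι → Set α)
    (hX : Pairwise (Function.onFun Disjoint X)) (x₀ : α) (hx₀ : ∀ i, x₀ ∉ X i)
    (hpp : ∀ i (h : H i), h ≠ 1 → ∀ x, x ∉ X i → φ i h • x ∈ X i)
    (w : CoprodI H) (hw : w ≠ 1) : ∃ i, lift φ w • x₀ ∈ X i := by
  classical
  -- Only the last letter sees the starting point; each later factor receives a point of a ping-pong
  -- set disjoint from its own.
  have hne : ∀ {i j : ι} (w : NeWord H i j), ∀ x, x ∉ X j → lift φ w.prod • x ∈ X i := by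
    intro i j w
    induction w with
    | singleton x hx =>
      intro y hy
      simpa using hpp _ x hx y hy
    | append w₁ hjk w₂ ih₁ ih₂ =>
      intro y hy
      simp only [NeWord.append_prod, map_mul, mul_smul]
      exact ih₁ _ (Set.disjoint_left.1 (hX hjk.symm) (ih₂ y hy))
  have hword : Word.equiv w ≠ Word.empty := by
    intro h
    apply hw
    rw [← Word.equiv.symm_apply_apply w, h]
    rfl
  obtain ⟨i, j, w', hw'⟩ := NeWord.of_word _ hword
  have : w'.prod = w := by
    rw [NeWord.prod, hw']
    exact Word.equiv.symm_apply_apply w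
  exact ⟨i, this ▸ hne w' x₀ (hx₀ j)⟩

end Monoid.CoprodI

/-- The ping-pong lemma for two cyclic groups, with a base point. -/
theorem Monoid.Coprod.lift_zpowers_smul_mem_of_ping_pong {G α : Type*} [Group G] [MulAction G α]
    {f g : G} {X Y : Set α} (hXY : Disjoint X Y) {x₀ : α} (hX : x₀ ∉ X) (hY : x₀ ∉ Y)
    (hf : ∀ h ∈ Subgroup.zpowers f, h ≠ 1 → ∀ x, x ∉ X → h • x ∈ X)
    (hg : ∀ h ∈ Subgroup.zpowers g, h ≠ 1 → ∀ x, x ∉ Y → h • x ∈ Y)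
    (w : Monoid.Coprod (Subgroup.zpowers f) (Subgroup.zpowers g)) (hw : w ≠ 1) :
    Monoid.Coprod.lift (Subgroup.zpowers f).subtype (Subgroup.zpowers g).subtype w • x₀ ∈
      X ∪ Y := by
  let s : Bool → G := fun b => bif b then f else g
  let H : Bool → Type _ := fun b => Subgroup.zpowers (s b)
  let _ : ∀ b, Group (H b) := fun b => inferInstanceAs (Group (Subgroup.zpowers (s b)))
  let φ : ∀ b, H b →* G := fun b => (Subgroup.zpowers (s b)).subtype
  let Z : Bool → Set α := fun b => bif b then X else Y
  let of : ∀ b, H b →* Monoid.CoprodI H := fun b => Monoid.CoprodI.of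
  let θ : Monoid.Coprod (Subgroup.zpowers f) (Subgroup.zpowers g) →* Monoid.CoprodI H :=
    Monoid.Coprod.lift (of true) (of false)
  let i : ∀ b, H b →* Monoid.Coprod (Subgroup.zpowers f) (Subgroup.zpowers g) := fun b =>
    match b with
    | true => Monoid.Coprod.inl
    | false => Monoid.Coprod.inr
  have hl (x : Subgroup.zpowers f) : θ (Monoid.Coprod.inl x) = of true x :=
    Monoid.Coprod.lift_apply_inl (M := Subgroup.zpowers f) (N := Subgroup.zpowers g)
      (of true) (of false) x
  have hr (x : Subgroup.zpowers g) : θ (Monoid.Coprod.inr x) = of false x :=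
    Monoid.Coprod.lift_apply_inr (M := Subgroup.zpowers f) (N := Subgroup.zpowers g)
      (of true) (of false) x
  -- A left inverse of `θ`: the passage from the binary free product to the one indexed by `Bool`
  -- loses no nontrivial word.
  have hθ : (Monoid.CoprodI.lift i).comp θ = MonoidHom.id _ := by
    apply Monoid.Coprod.hom_ext <;> ext x
    · exact (congrArg (Monoid.CoprodI.lift i) (hl x)).trans
        (Monoid.CoprodI.lift_of i (i := true) x)
    · exact (congrArg (Monoid.CoprodI.lift i) (hr x)).trans
        (Monoid.CoprodI.lift_of i (i := false) x)
  have hφ : (Monoid.CoprodI.lift φ).comp θ =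
      Monoid.Coprod.lift (Subgroup.zpowers f).subtype (Subgroup.zpowers g).subtype := by
    apply Monoid.Coprod.hom_ext <;> ext x
    · exact ((congrArg (Monoid.CoprodI.lift φ) (hl x)).trans
        (Monoid.CoprodI.lift_of φ (i := true) x)).trans (Monoid.Coprod.lift_apply_inl (Subgroup.zpowers f).subtype
          (Subgroup.zpowers g).subtype x).symm
    · exact ((congrArg (Monoid.CoprodI.lift φ) (hr x)).trans
        (Monoid.CoprodI.lift_of φ (i := false) x)).trans (Monoid.Coprod.lift_apply_inr (Subgroup.zpowers f).subtype
          (Subgroup.zpowers g).subtype x).symm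
  have hθw : θ w ≠ 1 := by
    intro h
    apply hw
    have := DFunLike.congr_fun hθ w
    rw [MonoidHom.comp_apply, h, map_one] at this
    exact this.symm
  obtain ⟨b, hb⟩ := Monoid.CoprodI.lift_smul_mem_of_ping_pong φ Z
    (by
      intro b c hbc
      cases b <;> cases c <;> simp_all [Z, Function.onFun, disjoint_comm]) x₀
    (by intro b; cases b <;> simpa [Z])
    (by
      intro b h hh
      have h1 : (h : Subgroup.zpowers (s b)).1 ≠ 1 := fun e => hh (Subtype.ext e)
      cases b
      · exact hg _ h.2 h1
      · exact hf _ h.2 h1) (θ w) hθw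
  rw [← MonoidHom.comp_apply, hφ] at hb
  cases b
  · exact Or.inr hb
  · exact Or.inl hb

theorem Subgroup.nonempty_zpowers_mulEquiv_zmod {G : Type*} [Group G] (f : G) :
    Nonempty (Subgroup.zpowers f ≃* Multiplicative (ZMod (orderOf f))) :=
  ⟨(zmodMulEquivOfGenerator (g := (⟨f, Subgroup.mem_zpowers f⟩ : Subgroup.zpowers f))
    (by
      rintro ⟨_, k, rfl⟩
      exact ⟨k, rfl⟩) (Nat.card_zpowers f)).symm⟩

/-- The isomorphism from the free product of two cyclic subgroups onto the subgroup that they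
generate, when the canonical homomorphism is injective. -/
theorem Monoid.Coprod.exists_mulEquiv_closure_pair {G : Type*} [Group G] {f g : G}
    (h : Function.Injective
      (Monoid.Coprod.lift (Subgroup.zpowers f).subtype (Subgroup.zpowers g).subtype)) :
    ∃ e : Monoid.Coprod (Subgroup.zpowers f) (Subgroup.zpowers g) ≃*
      Subgroup.closure ({f, g} : Set G),
      ∀ w, (e w : G) =
        Monoid.Coprod.lift (Subgroup.zpowers f).subtype (Subgroup.zpowers g).subtype w := by
  have hr : (Monoid.Coprod.lift (Subgroup.zpowers f).subtype
      (Subgroup.zpowers g).subtype).range = Subgroup.closure ({f, g} : Set G) := by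
    rw [Monoid.Coprod.range_lift, Subgroup.range_subtype, Subgroup.range_subtype,
      Subgroup.zpowers_eq_closure, Subgroup.zpowers_eq_closure, ← Subgroup.closure_union]
    rfl
  exact ⟨(MonoidHom.ofInjective h).trans (MulEquiv.subgroupCongr hr), fun w => rfl⟩

/-! ### Planar sectors and the quadratic inequality -/

namespace ComplexHyperbolic

/-- `z` lies in the open sector of half-angle `π / m` around the positive real axis. -/
def InSector (m : ℕ) (z : ℂ) : Prop :=
  Real.cos (Real.pi / m) * |z.im| < Real.sin (Real.pi / m) * z.re

theorem InSector.abs_arg_lt {m : ℕ} (hm : 2 ≤ m) {z : ℂ} (hz : InSector m z) :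
    |z.arg| < Real.pi / m := by
  have hm' : (2 : ℝ) ≤ m := by exact_mod_cast hm
  have hpi := Real.pi_pos
  have hle : Real.pi / m ≤ Real.pi / 2 := by gcongr
  have h0 : 0 < Real.pi / m := by positivity
  by_contra h
  rw [not_lt] at h
  rw [InSector, ← Complex.norm_mul_cos_arg, ← Complex.norm_mul_sin_arg, abs_mul, abs_norm,
    Real.abs_sin_eq_sin_abs_of_abs_le_pi (Complex.abs_arg_le_pi z),
    ← Real.cos_abs z.arg] at hz
  have h1 : 0 ≤ Real.sin (|z.arg| - Real.pi / m) :=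
    Real.sin_nonneg_of_nonneg_of_le_pi (by linarith) (by linarith [Complex.abs_arg_le_pi z])
  rw [Real.sin_sub] at h1
  nlinarith [mul_nonneg (norm_nonneg z) h1]

/-- A nontrivial rotation by an `m`-th root of unity moves the sector off itself. -/
theorem InSector.not_mul {m : ℕ} (hm : 2 ≤ m) {z ω : ℂ} (hz : InSector m z) (hω : ω ^ m = 1)
    (hω1 : ω ≠ 1) : ¬ InSector m (ω * z) := by
  intro hz'
  have hm0 : (0 : ℝ) < m := by positivity
  have hω0 : ω ≠ 0 := by
    rintro rfl
    rw [zero_pow (by omega)] at hω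
    exact zero_ne_one hω
  have hz0 : z ≠ 0 := by
    rintro rfl
    simp [InSector] at hz
  have hnorm : ‖ω‖ = 1 := Complex.norm_eq_one_of_pow_eq_one hω (by omega)
  have h1 := hz.abs_arg_lt hm
  have h2 := hz'.abs_arg_lt hm
  set d := (ω * z).arg - z.arg with hd
  have hexp : ω = Complex.exp (d * Complex.I) := by
    have e1 := Complex.norm_mul_exp_arg_mul_I z
    have e2 := Complex.norm_mul_exp_arg_mul_I (ω * z)
    rw [norm_mul, hnorm, one_mul] at e2
    rw [hd, Complex.ofReal_sub, sub_mul, Complex.exp_sub, eq_div_iff (Complex.exp_ne_zero _)]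
    have hn : (‖z‖ : ℂ) ≠ 0 := by exact_mod_cast norm_ne_zero_iff.2 hz0
    apply mul_left_cancel₀ hn
    rw [e2]
    conv_rhs => rw [← e1]
    ring
  have hd2 : |d| < 2 * Real.pi / m := by
    calc |d| ≤ |(ω * z).arg| + |z.arg| := abs_sub _ _
      _ < Real.pi / m + Real.pi / m := add_lt_add h2 h1
      _ = 2 * Real.pi / m := by ring
  -- Now `m * d` is a multiple of `2π` of absolute value below `2π`, so it vanishes.
  rw [hexp, ← Complex.exp_nat_mul, Complex.exp_eq_one_iff] at hω
  obtain ⟨k, hk⟩ := hω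
  have hk' : m * d = k * (2 * Real.pi) := by
    have : ((m * d : ℝ) : ℂ) * Complex.I = ((k * (2 * Real.pi) : ℝ) : ℂ) * Complex.I := by
      push_cast
      linear_combination hk
    exact_mod_cast mul_right_cancel₀ Complex.I_ne_zero this
  have hpi := Real.pi_pos
  have hk0 : |(k : ℝ)| < 1 := by
    have h3 : |(m : ℝ) * d| < 2 * Real.pi := by
      rw [abs_mul, abs_of_pos hm0]
      rw [lt_div_iff₀ hm0] at hd2
      linarith
    rw [hk', abs_mul, abs_of_pos (by positivity : 0 < 2 * Real.pi)] at h3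
    nlinarith
  have hk1 : k = 0 := by
    have : |k| < 1 := by exact_mod_cast hk0
    exact Int.abs_lt_one_iff.1 this
  rw [hk1] at hk'
  have hd0 : d = 0 := by
    have : (m : ℝ) * d = 0 := by simpa using hk'
    exact (mul_eq_zero.1 this).resolve_left hm0.ne'
  apply hω1
  rw [hexp, hd0]
  simp

/-- The quadratic form that governs two sectors with vertices at the distance `δ`, where
`K = cosh² (δ / 2)`. -/
theorem eq_zero_of_sectors {a b k k' D K R T : ℝ} (ha : 0 ≤ a) (hb : 0 ≤ b)
    (hD : 0 < D) (hD2 : D ^ 2 = (1 + k ^ 2) * (1 + k' ^ 2)) (hK : 1 < K)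
    (hKD : k * k' + D < 2 * K - 1) (hab : a * b = K * (R ^ 2 + T ^ 2))
    (h1 : a ≤ R + k * T) (h2 : b ≤ R + k' * T) : a = 0 := by
  have h3 : a * b ≤ (R + k * T) * (R + k' * T) :=
    mul_le_mul h1 h2 hb (ha.trans h1)
  -- By `hD2` this quantity equals `(2 * K - 1 - k * k') ^ 2 - D ^ 2`.
  have hdisc : 0 < 4 * (K - 1) * (K - k * k') - (k + k') ^ 2 := by
    nlinarith [mul_pos hD (sub_pos.2 hKD), mul_pos (sub_pos.2 hKD) (sub_pos.2 hKD)]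
  -- Complete the square in `K * (R ^ 2 + T ^ 2) - (R + k * T) * (R + k' * T)`, which is at most `0`
  -- by `h3` and `hab`, after multiplication by `4 * (K - 1)`.
  have h4 : (2 * (K - 1) * R - (k + k') * T) ^ 2 +
      (4 * (K - 1) * (K - k * k') - (k + k') ^ 2) * T ^ 2 ≤ 0 := by
    have : 0 ≤ 4 * (K - 1) * ((R + k * T) * (R + k' * T) - K * (R ^ 2 + T ^ 2)) := by
      apply mul_nonneg <;> linarith
    linarith
  have hT : T = 0 := by
    by_contra hT
    have : 0 < T ^ 2 := by positivity
    nlinarith [mul_pos hdisc this, sq_nonneg (2 * (K - 1) * R - (k + k') * T)]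
  subst hT
  have hR : R = 0 := by
    have h5 : (2 * (K - 1) * R) ^ 2 ≤ 0 := by simpa using h4
    have h6 : 2 * (K - 1) * R = 0 := by
      exact pow_eq_zero_iff two_ne_zero |>.1 (le_antisymm h5 (sq_nonneg _))
    rcases mul_eq_zero.1 h6 with h | h
    · linarith
    · exact h
  linarith

theorem sin_pi_div_pos {m : ℕ} (hm : 2 ≤ m) : 0 < Real.sin (Real.pi / m) := by
  have hm' : (2 : ℝ) ≤ m := by exact_mod_cast hm
  have hpi := Real.pi_pos
  apply Real.sin_pos_of_pos_of_lt_pi (by positivity)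
  rw [div_lt_iff₀ (by positivity)]
  nlinarith

/-- The complements of two sectors are disjoint when their vertices are far apart. -/
theorem eq_zero_of_not_inSector {m n : ℕ} (hm : 2 ≤ m) (hn : 2 ≤ n) {z w : ℂ} {a b K : ℝ}
    (ha : 0 ≤ a) (hb : 0 ≤ b) (hK : 1 < K)
    (hKD : (Real.cos (Real.pi / m) * Real.cos (Real.pi / n) + 1) /
        (Real.sin (Real.pi / m) * Real.sin (Real.pi / n)) < 2 * K - 1)
    (hzw : w = star z) (hab : a * b = K * ‖z‖ ^ 2)
    (h1 : ¬ InSector m (a + z)) (h2 : ¬ InSector n (b + w)) : a = 0 := by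
  have hs := sin_pi_div_pos hm
  have hs' := sin_pi_div_pos hn
  subst hzw
  have e1 := Real.sin_sq_add_cos_sq (Real.pi / m)
  have e2 := Real.sin_sq_add_cos_sq (Real.pi / n)
  simp only [InSector, not_lt, Complex.add_re, Complex.add_im, Complex.ofReal_re,
    Complex.ofReal_im, zero_add, Complex.star_def, Complex.conj_re, Complex.conj_im,
    abs_neg] at h1 h2
  generalize Real.sin (Real.pi / m) = s at *
  generalize Real.sin (Real.pi / n) = s' at *
  generalize Real.cos (Real.pi / m) = c at *
  generalize Real.cos (Real.pi / n) = c' at *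
  -- With `k`, `k'` the cotangents of the half-angles, `D` is the product of the cosecants, and `k *
  -- k' + D` is the bound of the theorem.
  refine eq_zero_of_sectors (k := c / s) (k' := c' / s') (D := 1 / (s * s')) (K := K) (R := -z.re)
    (T := |z.im|) ha hb (by positivity) ?_ hK ?_ ?_ ?_ ?_
  · field_simp
    rw [e1, e2]; norm_num
  · convert hKD using 1
    field_simp
  · rw [hab, ← Complex.normSq_eq_norm_sq, Complex.normSq_apply, sq_abs]
    ring
  · rw [mul_comm, ← le_div_iff₀ hs] at h1
    have : c * |z.im| / s = c / s * |z.im| := by ring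
    linarith
  · rw [mul_comm, ← le_div_iff₀ hs'] at h2
    have : c' * |z.im| / s' = c' / s' * |z.im| := by ring
    linarith

/-- This is `cos (x + y) ≥ -1`. It makes the hypothesis on the distance force the fixed sets apart.
-/
theorem one_le_cos_mul_cos_add_one_div {x y : ℝ} (hx : 0 < Real.sin x) (hy : 0 < Real.sin y) :
    1 ≤ (Real.cos x * Real.cos y + 1) / (Real.sin x * Real.sin y) := by
  rw [one_le_div (by positivity)]
  have := Real.neg_one_le_cos (x + y)
  rw [Real.cos_add] at this
  linarith

end ComplexHyperbolic

/-! ### Eigenvectors of complex reflections -/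

namespace ComplexHyperbolic

/-- `f` acts as a scalar on `a` and as a different scalar on the orthogonal complement of `a`. -/
def IsReflectionIn (f : PU21) (a : V) : Prop :=
  ∃ (B : U21) (μ ν : ℂ), (B : PU21) = f ∧ ‖μ‖ = 1 ∧ ‖ν‖ = 1 ∧ μ ≠ ν ∧
    B.val.val *ᵥ a = ν • a ∧ (∀ v, herm v a = 0 → B.val.val *ᵥ v = μ • v) ∧
    ∃ b, b ≠ 0 ∧ herm b a = 0

/-- `f` has the eigenvectors `p` and `p'`, and the order of `f` is the order of the quotient of
the eigenvalues. -/
def IsRotation (f : PU21) (p p' : V) : Prop :=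
  ∃ (B : U21) (α β : ℂ), (B : PU21) = f ∧ ‖α‖ = 1 ∧ ‖β‖ = 1 ∧
    B.val.val *ᵥ p = α • p ∧ B.val.val *ᵥ p' = β • p' ∧ ∀ k : ℕ, f ^ k = 1 ↔ α ^ k = β ^ k

theorem perp_add_smul (v a : V) : perp v a + (herm v a / (q a : ℂ)) • a = v := by
  simp [perp]

/-- The linear functional `⟨·, a⟩`. -/
noncomputable def hermLeft (a : V) : V →ₗ[ℂ] ℂ where
  toFun v := herm v a
  map_add' x y := herm_add_left x y a
  map_smul' c x := herm_smul_left c x a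

theorem hermLeft_ne_zero {a : V} (ha : a ≠ 0) : hermLeft a ≠ 0 := by
  intro h
  apply ha
  apply herm_nondegenerate
  intro v
  rw [← star_herm]
  have : herm v a = 0 := DFunLike.congr_fun h v
  rw [this, star_zero]

theorem mem_of_herm_eq_zero {E : Submodule ℂ V} (hE : Module.finrank ℂ E = 2) {a : V} (ha : a ≠ 0)
    (h : ∀ x ∈ E, herm x a = 0) {v : V} (hv : herm v a = 0) : v ∈ E := by
  have h1 := Module.Dual.finrank_ker_add_one_of_ne_zero (hermLeft_ne_zero ha)
  have h2 : Module.finrank ℂ V = 3 := by simp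
  have hle : E ≤ (hermLeft a).ker := h
  rw [Submodule.eq_of_le_of_finrank_eq hle (by omega)]
  exact hv

theorem exists_herm_eq_zero {E : Submodule ℂ V} (hE : Module.finrank ℂ E = 2) :
    ∃ a : V, a ≠ 0 ∧ ∀ x ∈ E, herm x a = 0 := by
  have hlt : E < ⊤ := by
    rw [lt_top_iff_ne_top]
    rintro rfl
    rw [finrank_top] at hE
    simp at hE
  obtain ⟨φ, hφ, hle⟩ := Submodule.exists_le_ker_of_lt_top E hlt
  -- The vector representing `φ` under the form; the order is reversed because `J` exchanges the
  -- outer coordinates.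
  let a : V := ![star (φ (Pi.single 2 1)), star (φ (Pi.single 1 1)), star (φ (Pi.single 0 1))]
  have ha : ∀ v, herm v a = φ v := by
    intro v
    conv_rhs => rw [LinearMap.pi_apply_eq_sum_univ φ v]
    simp only [Fin.sum_univ_three, herm_apply, a, smul_eq_mul]
    have e : ∀ j : Fin 3, (fun i => if j = i then (1 : ℂ) else 0) = Pi.single j 1 := by
      intro j; ext i; simp [Pi.single_apply, eq_comm]
    simp only [e]
    simp
    ring
  refine ⟨a, ?_, fun x hx => (ha x).trans (hle hx)⟩
  intro h0
  apply hφ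
  refine LinearMap.ext fun v => ?_
  have := ha v
  rw [h0] at this
  simpa [herm] using this.symm

theorem mem_eigen {B : U21} {μ : ℂ} {v : V} : v ∈ eigen B μ ↔ B.val.val *ᵥ v = μ • v := by
  rw [eigen, Module.End.mem_eigenspace_iff, Matrix.toLin'_apply]

/-- The vector `a` is polar to the two-dimensional eigenspace. It is positive since it is orthogonal
to a negative vector. -/
theorem IsLineReflection.exists_isReflectionIn {f : PU21} (hf : IsLineReflection f) :
    ∃ a, 0 < q a ∧ IsReflectionIn f a ∧ ∃ b, q b < 0 ∧ herm b a = 0 := by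
  obtain ⟨B, μ, hB, hE, -, w, hw, hqw⟩ := hf
  obtain ⟨a, ha0, ha⟩ := exists_herm_eq_zero hE
  have haw : herm a w = 0 := by rw [← star_herm, ha w hw, star_zero]
  have hqa : 0 < q a := q_pos_of_herm_eq_zero hqw haw ha0
  have hμ : ‖μ‖ = 1 := U21.norm_eq_one_of_eigen hqw.ne (mem_eigen.1 hw)
  set ν := herm (B.val.val *ᵥ a) a / (q a : ℂ) with hν
  -- This vector is orthogonal to `a`, hence lies in the eigenspace, and it is also orthogonal to
  -- the eigenspace because `B` is unitary. Since `a` and the eigenspace span everything,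
  -- nondegeneracy kills it.
  have hy : perp (B.val.val *ᵥ a) a = 0 := by
    have hyE : perp (B.val.val *ᵥ a) a ∈ eigen B μ :=
      mem_of_herm_eq_zero hE ha0 ha (herm_perp hqa.ne')
    have hyx : ∀ x ∈ eigen B μ, herm (perp (B.val.val *ᵥ a) a) x = 0 := by
      intro x hx
      have hax : herm a x = 0 := by rw [← star_herm, ha x hx, star_zero]
      rw [perp, herm_sub_left, herm_smul_left, hax,
        U21.herm_mulVec_of_eigen hμ (mem_eigen.1 hx), hax]
      simp
    apply herm_nondegenerate
    intro v
    rw [← perp_add_smul v a, herm_add_right, herm_smul_right, herm_perp hqa.ne',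
      hyx _ (mem_of_herm_eq_zero hE ha0 ha (herm_perp hqa.ne')), mul_zero, add_zero]
  have hBa : B.val.val *ᵥ a = ν • a := sub_eq_zero.1 hy
  refine ⟨a, hqa, ⟨B, μ, ν, hB, hμ, U21.norm_eq_one_of_eigen hqa.ne' hBa, ?_, hBa,
    fun v hv => mem_eigen.1 (mem_of_herm_eq_zero hE ha0 ha hv), w, ne_zero_of_q_neg hqw, ha w hw⟩,
    w, hqw, ha w hw⟩
  rintro h
  have := ha a (mem_eigen.2 (hBa.trans (by rw [h])))
  rw [herm_self] at this
  exact hqa.ne' (by exact_mod_cast this)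

theorem IsPointReflection.exists_isReflectionIn {f : PU21} (hf : IsPointReflection f) :
    ∃ a, q a < 0 ∧ IsReflectionIn f a := by
  obtain ⟨B, μ, ν, w, hB, hqw, hw, hE, hpos⟩ := hf
  have hw0 := ne_zero_of_q_neg hqw
  have hBw : B.val.val *ᵥ w = ν • w := by
    rw [← mem_eigen, hw]
    exact Submodule.mem_span_singleton_self w
  have hν := U21.norm_eq_one_of_eigen hqw.ne hBw
  have hμν : μ ≠ ν := by
    rintro rfl
    rw [hw, finrank_span_singleton hw0] at hE
    omega
  have hne : eigen B μ ≠ ⊥ := by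
    intro h
    rw [h, finrank_bot] at hE
    omega
  obtain ⟨b, hb, hb0⟩ := (Submodule.ne_bot_iff _).1 hne
  have hμ := U21.norm_eq_one_of_eigen (hpos b hb hb0).ne' (mem_eigen.1 hb)
  have horth : ∀ x ∈ eigen B μ, herm x w = 0 := by
    intro x hx
    have h := U21.herm_mulVec_of_eigen hν hBw x
    rw [mem_eigen.1 hx, herm_smul_left] at h
    have : (μ - ν) * herm x w = 0 := by rw [sub_mul, h, sub_self]
    exact (mul_eq_zero.1 this).resolve_left (sub_ne_zero.2 hμν)
  exact ⟨w, hqw, B, μ, ν, hB, hμ, hν, hμν, hBw,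
    fun v hv => mem_eigen.1 (mem_of_herm_eq_zero hE hw0 horth hv), b, hb0, horth b hb⟩

/-- Triviality in `PU21` means being scalar, and `B ^ k` is the scalar `ν ^ k` on `a` and `μ ^ k` on
its orthogonal complement. The vector `b` witnesses that the second eigenvalue occurs. -/
theorem mk_pow_eq_one_iff {B : U21} {μ ν : ℂ} {a : V} (ha : q a ≠ 0)
    (hBa : B.val.val *ᵥ a = ν • a) (hB : ∀ v, herm v a = 0 → B.val.val *ᵥ v = μ • v)
    {b : V} (hb : b ≠ 0) (hba : herm b a = 0) (k : ℕ) :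
    (B : PU21) ^ k = 1 ↔ μ ^ k = ν ^ k := by
  rw [← QuotientGroup.mk_pow, QuotientGroup.eq_one_iff]
  have ha0 : a ≠ 0 := by
    rintro rfl
    exact ha q_zero
  have h1 := U21.pow_mulVec_of_eigen hBa k
  have h2 := fun v hv => U21.pow_mulVec_of_eigen (hB v hv) k
  constructor
  · rintro ⟨c, hc⟩
    rw [hc, Matrix.smul_mulVec, Matrix.one_mulVec] at h1
    have h3 := h2 b hba
    rw [hc, Matrix.smul_mulVec, Matrix.one_mulVec] at h3
    rw [← smul_left_injective ℂ hb h3, ← smul_left_injective ℂ ha0 h1]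
  · intro h
    refine ⟨μ ^ k, ?_⟩
    apply Matrix.toLin'.injective
    ext1 i
    ext1
    simp only [LinearMap.comp_apply, Matrix.toLin'_apply, Matrix.smul_mulVec, Matrix.one_mulVec]
    generalize (LinearMap.single ℂ (fun _ => ℂ) i) 1 = v
    conv_lhs => rw [← perp_add_smul v a]
    rw [Matrix.mulVec_add, Matrix.mulVec_smul, h1, h2 _ (herm_perp ha), ← h, smul_comm,
      ← smul_add, perp_add_smul]

theorem IsReflectionIn.ne_one {f : PU21} {a : V} (ha : q a ≠ 0) (hf : IsReflectionIn f a) :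
    f ≠ 1 := by
  obtain ⟨B, μ, ν, rfl, hμ, hν, hne, hBa, hB, b, hb, hba⟩ := hf
  intro h
  apply hne
  simpa [h] using mk_pow_eq_one_iff ha hBa hB hb hba 1

/-- Used for point reflections, where the centre `a` is the vertex of the rotation;
`isRotation_right` serves line reflections, where the vertex `p` lies on the fixed line and `a` is
polar to it. -/
theorem IsReflectionIn.isRotation_left {f : PU21} {a p : V} (ha : q a ≠ 0)
    (hf : IsReflectionIn f a) (hp : herm p a = 0) : IsRotation f a p := by
  obtain ⟨B, μ, ν, rfl, hμ, hν, hne, hBa, hB, b, hb, hba⟩ := hf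
  exact ⟨B, ν, μ, rfl, hν, hμ, hBa, hB p hp, fun k =>
    (mk_pow_eq_one_iff ha hBa hB hb hba k).trans eq_comm⟩

theorem IsReflectionIn.isRotation_right {f : PU21} {a p : V} (ha : q a ≠ 0)
    (hf : IsReflectionIn f a) (hp : herm p a = 0) (c : ℂ) : IsRotation f p (c • a) := by
  obtain ⟨B, μ, ν, rfl, hμ, hν, hne, hBa, hB, b, hb, hba⟩ := hf
  refine ⟨B, μ, ν, rfl, hμ, hν, hB p hp, ?_, mk_pow_eq_one_iff ha hBa hB hb hba⟩
  rw [Matrix.mulVec_smul, hBa, smul_comm]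

theorem perp_add_of_herm_eq_zero {a p : V} (hp : q p ≠ 0) (hpa : herm a p = 0) (c d : ℂ) :
    perp (c • a + d • p) p = c • a := by
  have : (q p : ℂ) ≠ 0 := by exact_mod_cast hp
  rw [perp, herm_add_left, herm_smul_left, herm_smul_left, hpa, herm_self, mul_zero, zero_add,
    mul_div_cancel_right₀ _ this, add_sub_cancel_right]

/-! ### Fixed points and the Bergman distance -/

/-- `f` fixes the projective point of `p`. -/
def FixesVec (f : PU21) (p : V) : Prop :=
  ∃ (B : U21) (c : ℂ), (B : PU21) = f ∧ B.val.val *ᵥ p = c • p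

theorem IsReflectionIn.fixesVec {f : PU21} {a p : V} (hf : IsReflectionIn f a)
    (hp : herm p a = 0) : FixesVec f p := by
  obtain ⟨B, μ, ν, rfl, hμ, hν, hne, hBa, hB, -⟩ := hf
  exact ⟨B, μ, rfl, hB p hp⟩

theorem IsReflectionIn.fixesVec_self {f : PU21} {a : V} (hf : IsReflectionIn f a) :
    FixesVec f a := by
  obtain ⟨B, μ, ν, rfl, hμ, hν, hne, hBa, hB, -⟩ := hf
  exact ⟨B, ν, rfl, hBa⟩

theorem FixesVec.mk_mem_fixedSet {f : PU21} {p : V} (hp : q p < 0) (h : FixesVec f p) :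
    Projectivization.mk ℂ p (ne_zero_of_q_neg hp) ∈ fixedSet f := by
  obtain ⟨B, c, rfl, hB⟩ := h
  constructor
  · obtain ⟨u, hu⟩ := Projectivization.exists_smul_eq_mk_rep ℂ p (ne_zero_of_q_neg hp)
    have hu0 : 0 < ‖(u : ℂ)‖ := norm_pos_iff.2 u.ne_zero
    have : q ((u : ℂ) • p) < 0 := by
      rw [q_smul]
      exact mul_neg_of_pos_of_neg (by positivity) hp
    change q _ < 0
    rw [← hu]
    exact this
  · exact (Projectivization.mk_eq_mk_iff' ℂ (B.val.val *ᵥ p) p _ _).2 ⟨c, hB.symm⟩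

theorem one_le_herm_ratio {z w : V} (hz : q z < 0) (hw : q w < 0) :
    1 ≤ ‖herm z w‖ ^ 2 / (q z * q w) := by
  rw [one_le_div (mul_pos_of_neg_of_neg hz hw)]
  exact mul_q_le_norm_herm_sq hw

theorem bergmanDist_eq (z w : P2) :
    bergmanDist z w =
      2 * Real.arcosh (Real.sqrt (‖herm z.rep w.rep‖ ^ 2 / (q z.rep * q w.rep))) := by
  rw [bergmanDist, herm_mul_herm, Complex.ofReal_re]

theorem bergmanDist_nonneg {z w : P2} (hz : z ∈ CH2) (hw : w ∈ CH2) : 0 ≤ bergmanDist z w := by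
  rw [bergmanDist_eq]
  have := Real.arcosh_nonneg (Real.one_le_sqrt.2 (one_le_herm_ratio hz hw))
  positivity

theorem cosh_bergmanDist {z w : P2} (hz : z ∈ CH2) (hw : w ∈ CH2) :
    Real.cosh (bergmanDist z w) =
      2 * (‖herm z.rep w.rep‖ ^ 2 / (q z.rep * q w.rep)) - 1 := by
  have h := one_le_herm_ratio hz hw
  rw [bergmanDist_eq, Real.cosh_two_mul, Real.sinh_sq, Real.cosh_arcosh (Real.one_le_sqrt.2 h),
    Real.sq_sqrt (by linarith)]
  ring

theorem herm_ratio_smul {c d : ℂ} (hc : c ≠ 0) (hd : d ≠ 0) (z w : V) :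
    ‖herm (c • z) (d • w)‖ ^ 2 / (q (c • z) * q (d • w)) = ‖herm z w‖ ^ 2 / (q z * q w) := by
  rw [herm_smul_left, herm_smul_right, q_smul, q_smul, norm_mul, norm_mul, norm_star]
  have : ‖c‖ ^ 2 * ‖d‖ ^ 2 ≠ 0 := by simp [hc, hd]
  rw [← mul_div_mul_left _ (q z * q w) this]
  congr 1 <;> ring

/-- This bound alone transfers the hypothesis on `fixedDist` to a chosen pair of fixed points;
whether the infimum is attained there is irrelevant. -/
theorem cosh_fixedDist_le {f g : PU21} {p r : V} (hp : q p < 0) (hr : q r < 0)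
    (hfp : FixesVec f p) (hgr : FixesVec g r) :
    Real.cosh (fixedDist f g) ≤ 2 * (‖herm p r‖ ^ 2 / (q p * q r)) - 1 := by
  have h1 := hfp.mk_mem_fixedSet hp
  have h2 := hgr.mk_mem_fixedSet hr
  have hnn : ∀ x ∈ Set.image2 bergmanDist (fixedSet f) (fixedSet g), 0 ≤ x := by
    rintro _ ⟨z, hz, w, hw, rfl⟩
    exact bergmanDist_nonneg hz.1 hw.1
  have hle : fixedDist f g ≤ bergmanDist (Projectivization.mk ℂ p (ne_zero_of_q_neg hp))
      (Projectivization.mk ℂ r (ne_zero_of_q_neg hr)) :=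
    csInf_le ⟨0, hnn⟩ ⟨_, h1, _, h2, rfl⟩
  have h0 : 0 ≤ fixedDist f g := Real.sInf_nonneg hnn
  have hcosh := Real.cosh_le_cosh.2 (abs_le_abs_of_nonneg h0 hle)
  rw [cosh_bergmanDist h1.1 h2.1] at hcosh
  obtain ⟨u, hu⟩ := Projectivization.exists_smul_eq_mk_rep ℂ p (ne_zero_of_q_neg hp)
  obtain ⟨u', hu'⟩ := Projectivization.exists_smul_eq_mk_rep ℂ r (ne_zero_of_q_neg hr)
  rw [← hu, ← hu'] at hcosh
  exact hcosh.trans_eq (by rw [← herm_ratio_smul u.ne_zero u'.ne_zero p r]; rfl)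

end ComplexHyperbolic

/-! ### Sectors in the complex hyperbolic plane -/

namespace ComplexHyperbolic

theorem inSector_ofReal_mul {m : ℕ} {t : ℝ} (ht : 0 < t) {z : ℂ} :
    InSector m (t * z) ↔ InSector m z := by
  rw [InSector, InSector, Complex.re_ofReal_mul, Complex.im_ofReal_mul, abs_mul, abs_of_pos ht,
    mul_left_comm, mul_left_comm _ t, mul_lt_mul_iff_right₀ ht]

/-- The vectors whose projection to the span of `p` and `r` lies in the sector of half-angle
`π / m` with the vertex `p` around the ray from `p` to `r`. -/
def sectorSet (m : ℕ) (p r : V) : Set V :=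
  {v | InSector m (herm r p * star (herm v p) * herm v (perp r p))}

/-- The defining expression is multiplied by `‖c‖ ^ 2 > 0`, so the sector is a set of projective
points. -/
theorem smul_mem_sectorSet {m : ℕ} {p r v : V} {c : ℂ} (hc : c ≠ 0) :
    c • v ∈ sectorSet m p r ↔ v ∈ sectorSet m p r := by
  have h0 : 0 < ‖c‖ ^ 2 := by positivity
  simp only [sectorSet, Set.mem_ofPred_eq, herm_smul_left]
  conv_rhs => rw [← inSector_ofReal_mul h0]
  have h := Complex.mul_conj' c
  push_cast
  rw [← h, star_mul']
  simp only [Complex.star_def]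
  rw [iff_iff_eq]
  congr 1
  ring

theorem continuous_herm (w : V) : Continuous fun v => herm v w := by
  simp only [herm_apply]
  fun_prop

theorem isOpen_sectorSet (m : ℕ) (p r : V) : IsOpen (sectorSet m p r) := by
  have h1 := continuous_herm p
  have h2 := continuous_herm (perp r p)
  have h : Continuous fun v => herm r p * star (herm v p) * herm v (perp r p) := by fun_prop
  exact isOpen_lt (continuous_const.mul (Complex.continuous_im.comp h).abs)
    (continuous_const.mul (Complex.continuous_re.comp h))

/-- The `k`-th power multiplies the expression defining the sector by `(β / α) ^ k`, an `m`-th root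
of unity that differs from `1` unless the power is trivial. -/
theorem IsRotation.exists_mulVec_notMem_sectorSet {f : PU21} {m : ℕ} (hm : orderOf f = m)
    (hm2 : 2 ≤ m) {p r : V} (hf : IsRotation f p (perp r p)) {x : PU21}
    (hx : x ∈ Subgroup.zpowers f) (hx1 : x ≠ 1) :
    ∃ A : U21, (A : PU21) = x ∧ ∀ v ∈ sectorSet m p r, A.val.val *ᵥ v ∉ sectorSet m p r := by
  have hfin : IsOfFinOrder f := orderOf_pos_iff.1 (by omega)
  obtain ⟨k, rfl⟩ := hfin.mem_powers_iff_mem_zpowers.2 hx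
  obtain ⟨B, α, β, rfl, hα, hβ, hBα, hBβ, hord⟩ := hf
  refine ⟨B ^ k, rfl, fun v hv => ?_⟩
  have e1 := U21.herm_mulVec_of_eigen (by rw [norm_pow, hα, one_pow])
    (U21.pow_mulVec_of_eigen hBα k) v
  have e2 := U21.herm_mulVec_of_eigen (by rw [norm_pow, hβ, one_pow])
    (U21.pow_mulVec_of_eigen hBβ k) v
  have hα0 : α ≠ 0 := norm_ne_zero_iff.1 (by rw [hα]; exact one_ne_zero)
  have hstar : star α = α⁻¹ := by
    have h := Complex.mul_conj' α
    rw [hα] at h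
    exact eq_inv_of_mul_eq_one_right (by simpa using h)
  have key := InSector.not_mul (ω := (β / α) ^ k) hm2 hv
    (by
      rw [← pow_mul, mul_comm, pow_mul, div_pow, ← (hord m).1 (hm ▸ pow_orderOf_eq_one _),
        div_self (pow_ne_zero _ hα0), one_pow])
    (by
      intro h
      rw [div_pow, div_eq_one_iff_eq (pow_ne_zero _ hα0)] at h
      exact hx1 ((hord k).2 h.symm))
  intro h
  apply key
  rw [sectorSet, Set.mem_ofPred_eq, e1, e2, star_mul', star_pow, hstar] at h
  convert h using 1
  rw [div_pow, inv_pow]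
  ring

theorem herm_perp_right (v r p : V) :
    herm v (perp r p) = herm v r - herm p r / (q p : ℂ) * herm v p := by
  rw [perp, herm_sub_right, herm_smul_right, star_div₀, star_herm]
  simp

/-- Exchanging `p` and `r` conjugates the last summand, so the two sector conditions become
conditions on one complex number shifted by two nonnegative reals, as in `eq_zero_of_not_inSector`.
-/
theorem sector_expr_eq (v r p : V) : herm r p * star (herm v p) * herm v (perp r p) =
    ((‖herm p r‖ ^ 2 * ‖herm v p‖ ^ 2 / (-q p) : ℝ) : ℂ) +
      herm r p * star (herm v p) * herm v r := by
  have h1 := herm_mul_herm p r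
  have h2 := herm_mul_herm v p
  rw [← star_herm v p] at h2
  rw [herm_perp_right]
  push_cast at h1 h2 ⊢
  rw [← h1, ← h2]
  ring

theorem mem_sectorSet_or_mem_sectorSet {m n : ℕ} (hm : 2 ≤ m) (hn : 2 ≤ n) {p r : V}
    (hp : q p < 0) (hr : q r < 0)
    (hK : (Real.cos (Real.pi / m) * Real.cos (Real.pi / n) + 1) /
        (Real.sin (Real.pi / m) * Real.sin (Real.pi / n)) <
      2 * (‖herm p r‖ ^ 2 / (q p * q r)) - 1)
    {v : V} (hv : q v < 0) : v ∈ sectorSet m p r ∨ v ∈ sectorSet n r p := by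
  by_contra! hcon
  obtain ⟨h1, h2⟩ := hcon
  rw [sectorSet, Set.mem_ofPred_eq, sector_expr_eq] at h1 h2
  have hpr : 0 < ‖herm p r‖ :=
    norm_pos_iff.2 (herm_ne_zero hp.le (ne_zero_of_q_neg hp) hr)
  have hvp : 0 < ‖herm v p‖ :=
    norm_pos_iff.2 (herm_ne_zero hv.le (ne_zero_of_q_neg hv) hp)
  have hp' : 0 < -q p := neg_pos.2 hp
  have hr' : 0 < -q r := neg_pos.2 hr
  have hK1 : 1 < ‖herm p r‖ ^ 2 / (q p * q r) := by
    linarith [one_le_cos_mul_cos_add_one_div (sin_pi_div_pos hm) (sin_pi_div_pos hn)]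
  have := eq_zero_of_not_inSector hm hn (by positivity) (by positivity) hK1 hK
    (by simp only [star_mul', star_herm]; ring)
    (by
      rw [norm_mul, norm_mul, norm_star, norm_herm_comm r p]
      have := hp.ne
      have := hr.ne
      field_simp) h1 h2
  exact (by positivity : (0 : ℝ) < ‖herm p r‖ ^ 2 * ‖herm v p‖ ^ 2 / (-q p)).ne' this

/-- A vector in the intersection of the two sectors. -/
theorem exists_mem_sectorSet_inter {m n : ℕ} (hm : 2 ≤ m) (hn : 2 ≤ n) {p r : V}
    (hp : q p < 0) (hr : q r < 0) (hK : 1 < ‖herm p r‖ ^ 2 / (q p * q r)) :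
    ∃ v, q v < 0 ∧ v ∈ sectorSet m p r ∧ v ∈ sectorSet n r p := by
  have hPQ := mul_pos_of_neg_of_neg hp hr
  rw [one_lt_div hPQ] at hK
  have hN : herm p r * herm r p = ((‖herm p r‖ ^ 2 : ℝ) : ℂ) := herm_mul_herm p r
  set N := ‖herm p r‖ ^ 2
  have hN0 : 0 < N := hPQ.trans hK
  have hx : herm (p - herm p r • r) p = ((q p - N : ℝ) : ℂ) := by
    rw [herm_sub_left, herm_smul_left, herm_self, hN]
    push_cast; rfl
  have hy : herm (p - herm p r • r) r = herm p r * ((1 - q r : ℝ) : ℂ) := by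
    rw [herm_sub_left, herm_smul_left, herm_self]
    push_cast; ring
  have hreal : ∀ {j : ℕ} {t : ℝ}, 2 ≤ j → 0 < t → InSector j (t : ℂ) := by
    intro j t hj ht
    have := sin_pi_div_pos hj
    simp only [InSector, Complex.ofReal_im, abs_zero, mul_zero, Complex.ofReal_re]
    positivity
  have hpc : (q p : ℂ) ≠ 0 := by exact_mod_cast hp.ne
  have hrc : (q r : ℂ) ≠ 0 := by exact_mod_cast hr.ne
  -- The product of `p` with `-herm p r • r` is a negative real, so their sum lies on the geodesic
  -- segment between the two fixed points. There both sector expressions are positive reals.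
  refine ⟨p - herm p r • r, ?_, ?_, ?_⟩
  · have h : herm (p - herm p r • r) (p - herm p r • r) =
        ((q p - N - N * (1 - q r) : ℝ) : ℂ) := by
      rw [herm_sub_right, herm_smul_right, hx, hy, star_herm, ← mul_assoc, mul_comm (herm r p), hN]
      push_cast; ring
    rw [herm_self] at h
    have h' : q (p - herm p r • r) = q p - N - N * (1 - q r) := by exact_mod_cast h
    rw [h']
    nlinarith [mul_pos hN0 (neg_pos.2 hr)]
  · rw [sectorSet, Set.mem_ofPred_eq, herm_perp_right, hx, hy]
    have e : herm r p * star (((q p - N : ℝ) : ℂ)) *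
        (herm p r * ((1 - q r : ℝ) : ℂ) - herm p r / (q p : ℂ) * ((q p - N : ℝ) : ℂ)) =
        ((N * ((N - q p) * (N - q p * q r) / (-q p)) : ℝ) : ℂ) := by
      rw [Complex.star_def, Complex.conj_ofReal, Complex.ofReal_mul N, ← hN]
      push_cast
      field_simp
      ring
    rw [e]
    apply hreal hm
    have h1 : 0 < N - q p := by linarith
    have h2 : 0 < N - q p * q r := by linarith
    have h3 : 0 < - q p := by linarith
    positivity
  · rw [sectorSet, Set.mem_ofPred_eq, herm_perp_right, hx, hy]
    have e : herm p r * star (herm p r * ((1 - q r : ℝ) : ℂ)) *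
        (((q p - N : ℝ) : ℂ) - herm r p / (q r : ℂ) * (herm p r * ((1 - q r : ℝ) : ℂ))) =
        ((N * ((1 - q r) * (N - q p * q r) / (-q r)) : ℝ) : ℂ) := by
      rw [star_mul', star_herm, Complex.star_def, Complex.conj_ofReal, Complex.ofReal_mul N, ← hN]
      have hN' : ((q p - N : ℝ) : ℂ) = q p - herm p r * herm r p := by rw [hN]; push_cast; rfl
      have hN'' : ((N - q p * q r : ℝ) : ℂ) = herm p r * herm r p - q p * q r := by
        rw [hN]; push_cast; rfl
      rw [hN', Complex.ofReal_div, Complex.ofReal_mul, hN'']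
      push_cast
      field_simp
      ring
    rw [e]
    apply hreal hn
    have h1 : 0 < 1 - q r := by linarith
    have h2 : 0 < N - q p * q r := by linarith
    have h3 : 0 < - q r := by linarith
    positivity

/-! ### Ping-pong inside `PU21` and discreteness -/

/-- The elements of `PU(2,1)` that move the projective point of `v` into the cone `S`. -/
def moverSet (S : Set V) (v : V) : Set PU21 :=
  {x | ∃ A : U21, (A : PU21) = x ∧ A.val.val *ᵥ v ∈ S}

theorem mk_mem_moverSet {S : Set V} (hS : ∀ (c : ℂ) (w : V), c ≠ 0 → (c • w ∈ S ↔ w ∈ S))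
    {v : V} (A : U21) : (A : PU21) ∈ moverSet S v ↔ A.val.val *ᵥ v ∈ S := by
  refine ⟨?_, fun h => ⟨A, rfl, h⟩⟩
  rintro ⟨B, hBA, hB⟩
  obtain ⟨c, hc⟩ := QuotientGroup.eq.1 hBA
  have hA : A.val.val = c • B.val.val := by
    have : A = B * (B⁻¹ * A) := by group
    rw [this, Subgroup.coe_mul, Units.val_mul, hc, mul_smul_comm, mul_one]
  have hc0 : c ≠ 0 := by
    rintro rfl
    rw [zero_smul] at hA
    exact A.val.ne_zero hA
  rwa [hA, Matrix.smul_mulVec, hS c _ hc0]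

theorem isOpen_moverSet {S : Set V} (hS : ∀ (c : ℂ) (w : V), c ≠ 0 → (c • w ∈ S ↔ w ∈ S))
    (hSo : IsOpen S) (v : V) : IsOpen (moverSet S v) := by
  rw [← (QuotientGroup.isQuotientMap_mk scalars).isOpen_preimage]
  have h : ((↑) : U21 → PU21) ⁻¹' moverSet S v = (fun A : U21 => A.val.val *ᵥ v) ⁻¹' S := by
    ext A
    exact mk_mem_moverSet hS A
  rw [h]
  apply hSo.preimage
  have : Continuous fun A : U21 => A.val.val := Units.continuous_val.comp continuous_subtype_val
  exact this.matrix_mulVec continuous_const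

theorem discreteTopology_of_isOpen {G : Type*} [Group G] [TopologicalSpace G] [IsTopologicalGroup G]
    {Γ : Subgroup G} {U : Set G} (hU : IsOpen U) (h1 : 1 ∈ U) (h : ∀ x ∈ Γ, x ∈ U → x = 1) :
    DiscreteTopology Γ := by
  apply discreteTopology_of_isOpen_singleton_one
  convert hU.preimage (continuous_subtype_val : Continuous ((↑) : Γ → G))
  ext x
  simp only [Set.mem_singleton_iff, Set.mem_preimage]
  exact ⟨fun hx => hx ▸ h1, fun hx => Subtype.ext (h x x.2 hx)⟩

/-- Two rotations of a complex line whose fixed points are far apart generate the free product of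
the cyclic groups that they generate, and this group is discrete. -/
theorem discrete_and_free_product_of_isRotation {f g : PU21} {m n : ℕ} (hm : orderOf f = m)
    (hn : orderOf g = n) (hm2 : 2 ≤ m) (hn2 : 2 ≤ n) {p r : V} (hp : q p < 0) (hr : q r < 0)
    (hf : IsRotation f p (perp r p)) (hg : IsRotation g r (perp p r))
    (hK : (Real.cos (Real.pi / m) * Real.cos (Real.pi / n) + 1) /
        (Real.sin (Real.pi / m) * Real.sin (Real.pi / n)) <
      2 * (‖herm p r‖ ^ 2 / (q p * q r)) - 1) :
    DiscreteTopology (Subgroup.closure ({f, g} : Set PU21)) ∧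
    Function.Injective
      (Monoid.Coprod.lift (Subgroup.zpowers f).subtype (Subgroup.zpowers g).subtype) := by
  obtain ⟨v, hv, hvp, hvr⟩ := exists_mem_sectorSet_inter hm2 hn2 hp hr (by
    linarith [one_le_cos_mul_cos_add_one_div (sin_pi_div_pos hm2) (sin_pi_div_pos hn2)])
  have hinv : ∀ (j : ℕ) (p r : V) (c : ℂ) (w : V), c ≠ 0 →
      (c • w ∈ sectorSet j p r ↔ w ∈ sectorSet j p r) := fun _ _ _ _ _ hc => smul_mem_sectorSet hc
  have hmem := fun (j : ℕ) (p r : V) (A : U21) => mk_mem_moverSet (hinv j p r) (v := v) A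
  set X := moverSet (sectorSet m p r) v with hX
  set Y := moverSet (sectorSet n r p) v with hY
  have h1X : (1 : PU21) ∈ X := ⟨1, rfl, by simpa using hvp⟩
  have h1Y : (1 : PU21) ∈ Y := ⟨1, rfl, by simpa using hvr⟩
  -- The group acts on itself by left multiplication, with base point `1`; the ping-pong sets are
  -- the complements of `X` and `Y`.
  have hdisj : Disjoint Xᶜ Yᶜ := by
    rw [Set.disjoint_left]
    intro x hx hy
    induction x using QuotientGroup.induction_on with
    | H A =>
      rw [Set.mem_compl_iff, hmem] at hx hy
      have hA : q (A.val.val *ᵥ v) < 0 := by rwa [U21.q_mulVec]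
      exact (mem_sectorSet_or_mem_sectorSet hm2 hn2 hp hr hK hA).elim hx hy
  have hmove : ∀ {f : PU21} {m : ℕ} {p r : V}, orderOf f = m → 2 ≤ m →
      IsRotation f p (perp r p) → ∀ h ∈ Subgroup.zpowers f, h ≠ 1 →
      ∀ x, x ∉ (moverSet (sectorSet m p r) v)ᶜ → h • x ∈ (moverSet (sectorSet m p r) v)ᶜ := by
    intro f m p r hm hm2 hf h hh hh1 x hx
    obtain ⟨A, rfl, hA⟩ := hf.exists_mulVec_notMem_sectorSet hm hm2 hh hh1
    rw [Set.notMem_compl_iff] at hx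
    obtain ⟨B, rfl, hB⟩ := hx
    rw [smul_eq_mul, ← QuotientGroup.mk_mul, Set.mem_compl_iff, hmem, Subgroup.coe_mul,
      Units.val_mul, ← Matrix.mulVec_mulVec]
    exact hA _ hB
  have hpp := Monoid.Coprod.lift_zpowers_smul_mem_of_ping_pong hdisj
    (Set.notMem_compl_iff.2 h1X) (Set.notMem_compl_iff.2 h1Y) (hmove hm hm2 hf) (hmove hn hn2 hg)
  simp only [smul_eq_mul, mul_one] at hpp
  have hinj : Function.Injective
      (Monoid.Coprod.lift (Subgroup.zpowers f).subtype (Subgroup.zpowers g).subtype) := by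
    rw [injective_iff_map_eq_one]
    intro w hw
    by_contra hne
    have := hpp w hne
    rw [hw] at this
    exact this.elim (fun h => h h1X) (fun h => h h1Y)
  refine ⟨discreteTopology_of_isOpen
    ((isOpen_moverSet (hinv m p r) (isOpen_sectorSet m p r) v).inter
      (isOpen_moverSet (hinv n r p) (isOpen_sectorSet n r p) v)) ⟨h1X, h1Y⟩ ?_, hinj⟩
  intro x hx hxU
  obtain ⟨e, he⟩ := Monoid.Coprod.exists_mulEquiv_closure_pair hinj
  by_contra hx1
  have hw : e.symm ⟨x, hx⟩ ≠ 1 := by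
    intro h
    rw [MulEquiv.symm_apply_eq, map_one] at h
    exact hx1 (congrArg Subtype.val h)
  have := hpp _ hw
  rw [← he, MulEquiv.apply_symm_apply] at this
  exact this.elim (fun h => h hxU.1) (fun h => h hxU.2)

end ComplexHyperbolic

/-! ### Choice of the fixed points -/

namespace ComplexHyperbolic

/-- Two complex lines whose polar vectors span a subspace that is not indefinite are at the
distance `0`. -/
theorem cosh_fixedDist_le_one {f g : PU21} {a b : V} (ha : 0 < q a)
    (hf : ∀ p, herm p a = 0 → FixesVec f p) (hg : ∀ p, herm p b = 0 → FixesVec g p)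
    (hfa : ∃ p, q p < 0 ∧ herm p a = 0) (hgb : ∃ r, q r < 0 ∧ herm r b = 0)
    (hab : ‖herm a b‖ ^ 2 ≤ q a * q b) : Real.cosh (fixedDist f g) ≤ 1 := by
  obtain ⟨p, hp, hpa⟩ := hfa
  obtain ⟨r, hr, hrb⟩ := hgb
  have hac : (q a : ℂ) ≠ 0 := by exact_mod_cast ha.ne'
  have common : ∀ {x : V}, q x < 0 → herm x a = 0 → herm x b = 0 →
      Real.cosh (fixedDist f g) ≤ 1 := by
    intro x hx hxa hxb
    refine (cosh_fixedDist_le hx hx (hf x hxa) (hg x hxb)).trans_eq ?_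
    rw [herm_self, Complex.norm_real, Real.norm_eq_abs, sq_abs, sq,
      div_self (mul_pos_of_neg_of_neg hx hx).ne']
    norm_num
  set b' := perp b a with hb'
  have hb'a : herm b' a = 0 := herm_perp ha.ne'
  have hq : 0 ≤ q b' := by
    rw [hb', q_perp ha.ne', sub_nonneg, div_le_iff₀ ha, norm_herm_comm, mul_comm]
    exact hab
  have hb : ∀ {x : V}, herm x a = 0 → herm x b' = 0 → herm x b = 0 := by
    intro x hxa hxb
    rw [← perp_add_smul b a, herm_add_right, herm_smul_right, hxa, ← hb', hxb]
    simp
  -- If `b'` is positive, `a` and `b` span a positive definite plane, and projecting `p` off `b'`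
  -- gives a common point of the two lines.
  rcases hq.lt_or_eq with hq | hq
  · refine common (x := perp p b') ?_ ?_ (hb ?_ (herm_perp hq.ne'))
    · rw [q_perp hq.ne']
      have : 0 ≤ ‖herm p b'‖ ^ 2 / q b' := by positivity
      linarith
    · rw [perp, herm_sub_left, herm_smul_left, hpa, hb'a, mul_zero, sub_zero]
    · rw [perp, herm_sub_left, herm_smul_left, hpa, hb'a, mul_zero, sub_zero]
  -- If `b' = 0`, then `b` is a multiple of `a` and `p` lies on both lines. Otherwise `b'` is null
  -- and orthogonal to `a` and `b`: a common ideal point of two asymptotic lines.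
  by_cases h0 : b' = 0
  · exact common hp hpa (hb hpa (by rw [h0]; simp [herm]))
  have hnn : herm b' b' = 0 := by rw [herm_self, ← hq, Complex.ofReal_zero]
  have hb'b : herm b' b = 0 := hb hb'a hnn
  have hpn : herm b' p ≠ 0 := herm_ne_zero hq.ge h0 hp
  have hrn : herm b' r ≠ 0 := herm_ne_zero hq.ge h0 hr
  -- normalize `p` and `r` so that `⟨b', p⟩ = ⟨b', r⟩ = -1`, and move them towards `b'`
  have norm_vec : ∀ {x : V}, q x < 0 → herm b' x ≠ 0 → ∃ c : ℂ, q (c • x) < 0 ∧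
      herm b' (c • x) = -1 ∧ herm (c • x) b' = -1 := by
    intro x hx hxn
    refine ⟨star (-(herm b' x)⁻¹), ?_, ?_, ?_⟩
    · rw [q_smul]
      apply mul_neg_of_pos_of_neg _ hx
      have : star (-(herm b' x)⁻¹) ≠ 0 := by simpa using hxn
      positivity
    · rw [herm_smul_right, star_star]
      field_simp
    · rw [herm_smul_left, ← star_herm b' x, ← star_mul', neg_mul, inv_mul_cancel₀ hxn]
      simp
  obtain ⟨c, hqc, hc1, hc2⟩ := norm_vec hp hpn
  obtain ⟨d, hqd, hd1, hd2⟩ := norm_vec hr hrn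
  have hca : herm (c • p) a = 0 := by rw [herm_smul_left, hpa, mul_zero]
  have hdb : herm (d • r) b = 0 := by rw [herm_smul_left, hrb, mul_zero]
  generalize c • p = p' at *
  generalize d • r = r' at *
  have hqt : ∀ {x : V}, herm b' x = -1 → herm x b' = -1 → ∀ t : ℝ,
      q (x + (t : ℂ) • b') = q x - 2 * t := by
    intro x h1 h2 t
    have h : herm (x + (t : ℂ) • b') (x + (t : ℂ) • b') = ((q x - 2 * t : ℝ) : ℂ) := by
      rw [herm_add_left, herm_add_right, herm_add_right, herm_smul_left, herm_smul_left,
        herm_smul_right, herm_smul_right, hnn, h1, h2, herm_self, Complex.star_def,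
        Complex.conj_ofReal]
      push_cast; ring
    rw [herm_self] at h
    exact_mod_cast h
  -- Numerator and denominator are divided by `t ^ 2`, so that the limit `t → ∞` becomes continuity
  -- in `t⁻¹` at `0`, where the right-hand side equals `1`.
  have hbound : ∀ t : ℝ, 0 < t → Real.cosh (fixedDist f g) ≤
      2 * (‖herm p' r' * ((t⁻¹ : ℝ) : ℂ) - 2‖ ^ 2 /
        ((q p' * t⁻¹ - 2) * (q r' * t⁻¹ - 2))) - 1 := by
    intro t ht
    have e1 := hqt hc1 hc2 t
    have e2 := hqt hd1 hd2 t
    have e3 : herm (p' + (t : ℂ) • b') (r' + (t : ℂ) • b') = herm p' r' - 2 * t := by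
      rw [herm_add_left, herm_add_right, herm_add_right, herm_smul_left, herm_smul_left,
        herm_smul_right, herm_smul_right, hnn, hd1, hc2, Complex.star_def, Complex.conj_ofReal]
      ring
    have hle := cosh_fixedDist_le (f := f) (g := g) (p := p' + (t : ℂ) • b')
      (r := r' + (t : ℂ) • b') (by rw [e1]; linarith) (by rw [e2]; linarith)
      (hf _ (by rw [herm_add_left, herm_smul_left, hca, hb'a]; simp))
      (hg _ (by rw [herm_add_left, herm_smul_left, hdb, hb'b]; simp))
    rw [e1, e2, e3] at hle
    refine hle.trans_eq ?_
    have e4 : herm p' r' * ((t⁻¹ : ℝ) : ℂ) - 2 = ((t⁻¹ : ℝ) : ℂ) * (herm p' r' - 2 * t) := by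
      have : (t : ℂ) ≠ 0 := by exact_mod_cast ht.ne'
      push_cast
      field_simp
    rw [e4, norm_mul, Complex.norm_real, Real.norm_eq_abs, mul_pow, sq_abs]
    have h1 : q p' - 2 * t ≠ 0 := by linarith
    have h2 : q r' - 2 * t ≠ 0 := by linarith
    congr 2
    have e5 : (q p' * t⁻¹ - 2) * (q r' * t⁻¹ - 2) =
        t⁻¹ ^ 2 * ((q p' - 2 * t) * (q r' - 2 * t)) := by
      field_simp
    rw [e5, mul_div_mul_left _ _ (by positivity)]
  have hcont : ContinuousAt (fun s : ℝ => 2 * (‖herm p' r' * (s : ℂ) - 2‖ ^ 2 /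
      ((q p' * s - 2) * (q r' * s - 2))) - 1) 0 := by
    apply ContinuousAt.sub _ continuousAt_const
    apply ContinuousAt.mul continuousAt_const
    apply ContinuousAt.div
    · exact Continuous.continuousAt (by fun_prop)
    · exact Continuous.continuousAt (by fun_prop)
    · norm_num
  have hlim := hcont.tendsto.comp tendsto_inv_atTop_zero
  refine (ge_of_tendsto hlim ?_).trans_eq (by norm_num)
  filter_upwards [Filter.eventually_gt_atTop 0] with t ht
  exact hbound t ht

theorem IsReflectionIn.two_le_orderOf {f : PU21} {a : V} (ha : q a ≠ 0) (hf : IsReflectionIn f a)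
    (h0 : 0 < orderOf f) : 2 ≤ orderOf f := by
  have h1 : orderOf f ≠ 1 := fun h => hf.ne_one ha (orderOf_eq_one_iff.1 h)
  omega

/-- The rotation about `p` when `f` is a reflection in the line with the polar vector `a`. -/
theorem IsReflectionIn.isRotation_perp {f : PU21} {a p r : V} (ha : q a ≠ 0) (hp : q p ≠ 0)
    (hf : IsReflectionIn f a) (hpa : herm p a = 0) {c d : ℂ} (hr : r = c • a + d • p) :
    IsRotation f p (perp r p) := by
  rw [hr, perp_add_of_herm_eq_zero hp (by rw [← star_herm, hpa, star_zero])]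
  exact hf.isRotation_right ha hpa c

/-- There are points fixed by `f` and `g` such that `f` and `g` preserve the complex line through
them, on which they are rotations about these points. -/
theorem exists_isRotation {f g : PU21} (hfg : (IsLineReflection f ∧ IsLineReflection g) ∨
      (IsLineReflection f ∧ IsPointReflection g) ∨
      (IsPointReflection f ∧ IsPointReflection g))
    (hδ : 1 < Real.cosh (fixedDist f g)) :
    ∃ p r, q p < 0 ∧ q r < 0 ∧ FixesVec f p ∧ FixesVec g r ∧
      IsRotation f p (perp r p) ∧ IsRotation g r (perp p r) := by
  rcases hfg with ⟨hf, hg⟩ | ⟨hf, hg⟩ | ⟨hf, hg⟩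
  · obtain ⟨a, ha, hfa, hneg⟩ := hf.exists_isReflectionIn
    obtain ⟨b, hb, hgb, hneg'⟩ := hg.exists_isReflectionIn
    have hab : q a * q b < ‖herm a b‖ ^ 2 := by
      by_contra! h
      exact hδ.not_ge (cosh_fixedDist_le_one ha (fun p hp => hfa.fixesVec hp)
        (fun r hr => hgb.fixesVec hr) hneg hneg' h)
    have hpa : herm (perp b a) a = 0 := herm_perp ha.ne'
    have hrb : herm (perp a b) b = 0 := herm_perp hb.ne'
    have hp : q (perp b a) < 0 := by
      rw [q_perp ha.ne', sub_neg, lt_div_iff₀ ha, norm_herm_comm, mul_comm]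
      exact hab
    have hr : q (perp a b) < 0 := by
      rw [q_perp hb.ne', sub_neg, lt_div_iff₀ hb]
      exact hab
    -- This places `r` in the span of `a` and `p`, so that `perp r p` is a multiple of the
    -- eigenvector `a`; exchanging `a` and `b` does the same for `g`.
    have key : ∀ a b : V, perp a b =
        (1 - herm a b / (q b : ℂ) * (herm b a / (q a : ℂ))) • a +
          (-(herm a b / (q b : ℂ))) • perp b a := by
      intro a b
      simp only [perp]
      module
    exact ⟨perp b a, perp a b, hp, hr, hfa.fixesVec hpa, hgb.fixesVec hrb,
      hfa.isRotation_perp ha.ne' hp.ne hpa (key a b),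
      hgb.isRotation_perp hb.ne' hr.ne hrb (key b a)⟩
  · obtain ⟨a, ha, hfa, -⟩ := hf.exists_isReflectionIn
    obtain ⟨b, hb, hgb⟩ := hg.exists_isReflectionIn
    have hpa : herm (perp b a) a = 0 := herm_perp ha.ne'
    have hp : q (perp b a) < 0 := by
      rw [q_perp ha.ne']
      have : 0 ≤ ‖herm b a‖ ^ 2 / q a := by positivity
      linarith
    refine ⟨perp b a, b, hp, hb, hfa.fixesVec hpa, hgb.fixesVec_self,
      hfa.isRotation_perp ha.ne' hp.ne hpa (c := herm b a / (q a : ℂ)) (d := 1) ?_,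
      hgb.isRotation_left hb.ne (herm_perp hb.ne)⟩
    rw [one_smul, add_comm, perp_add_smul]
  · obtain ⟨a, ha, hfa⟩ := hf.exists_isReflectionIn
    obtain ⟨b, hb, hgb⟩ := hg.exists_isReflectionIn
    exact ⟨a, b, ha, hb, hfa.fixesVec_self, hgb.fixesVec_self,
      hfa.isRotation_left ha.ne (herm_perp ha.ne), hgb.isRotation_left hb.ne (herm_perp hb.ne)⟩

theorem IsLineReflection.two_le_orderOf {f : PU21} (hf : IsLineReflection f)
    (h0 : 0 < orderOf f) : 2 ≤ orderOf f := by
  obtain ⟨a, ha, hfa, -⟩ := hf.exists_isReflectionIn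
  exact hfa.two_le_orderOf ha.ne' h0

theorem IsPointReflection.two_le_orderOf {f : PU21} (hf : IsPointReflection f)
    (h0 : 0 < orderOf f) : 2 ≤ orderOf f := by
  obtain ⟨a, ha, hfa⟩ := hf.exists_isReflectionIn
  exact hfa.two_le_orderOf ha.ne h0

end ComplexHyperbolic

theorem theorem3 (f g : PU21) (m n : ℕ)
    (hf : IsElliptic f) (hg : IsElliptic g)
    (hm : orderOf f = m) (hn : orderOf g = n) (hm0 : 0 < m) (hn0 : 0 < n)
    (hfg : (IsLineReflection f ∧ IsLineReflection g) ∨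
      (IsLineReflection f ∧ IsPointReflection g) ∨
      (IsPointReflection f ∧ IsPointReflection g))
    (hδ : (Real.cos (Real.pi / m) * Real.cos (Real.pi / n) + 1) /
        (Real.sin (Real.pi / m) * Real.sin (Real.pi / n)) < Real.cosh (fixedDist f g)) :
    DiscreteTopology (Subgroup.closure ({f, g} : Set PU21)) ∧
    (∃ e : Monoid.Coprod (Subgroup.zpowers f) (Subgroup.zpowers g) ≃*
          Subgroup.closure ({f, g} : Set PU21),
        (∀ x : Subgroup.zpowers f, (e (Monoid.Coprod.inl x) : PU21) = x) ∧
        (∀ y : Subgroup.zpowers g, (e (Monoid.Coprod.inr y) : PU21) = y)) ∧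
    Nonempty (Subgroup.closure ({f, g} : Set PU21) ≃*
      Monoid.Coprod (Multiplicative (ZMod m)) (Multiplicative (ZMod n))) := by
  have hm2 : 2 ≤ m := by
    subst hm
    rcases hfg with ⟨h, -⟩ | ⟨h, -⟩ | ⟨h, -⟩ <;> exact h.two_le_orderOf hm0
  have hn2 : 2 ≤ n := by
    subst hn
    rcases hfg with ⟨-, h⟩ | ⟨-, h⟩ | ⟨-, h⟩ <;> exact h.two_le_orderOf hn0
  have hδ1 : 1 < Real.cosh (fixedDist f g) :=
    (one_le_cos_mul_cos_add_one_div (sin_pi_div_pos hm2) (sin_pi_div_pos hn2)).trans_lt hδ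
  obtain ⟨p, r, hp, hr, hfp, hgr, hfrot, hgrot⟩ := exists_isRotation hfg hδ1
  obtain ⟨hdisc, hinj⟩ := discrete_and_free_product_of_isRotation hm hn hm2 hn2 hp hr hfrot hgrot
    (hδ.trans_le (cosh_fixedDist_le hp hr hfp hgr))
  obtain ⟨e, he⟩ := Monoid.Coprod.exists_mulEquiv_closure_pair hinj
  obtain ⟨e₁⟩ := Subgroup.nonempty_zpowers_mulEquiv_zmod f
  obtain ⟨e₂⟩ := Subgroup.nonempty_zpowers_mulEquiv_zmod g
  subst hm hn
  exact ⟨hdisc, ⟨e, fun x => (he _).trans (Monoid.Coprod.lift_apply_inl _ _ x),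
    fun y => (he _).trans (Monoid.Coprod.lift_apply_inr _ _ y)⟩,
    ⟨e.symm.trans (MulEquiv.coprodCongr e₁ e₂)⟩⟩
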